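/- Let $(M,Z)$ be a three-dimensional $b$-manifold: an oriented smooth $3$-manifold $M$ together with an oriented, closed embedded hypersurface $Z\subset M$. Its $b$-vector fields are the smooth vector fields on $M$ tangent to $Z$; they are the sections of the $b$-tangent bundle ${}^bTM$. A $b$-metric is a smooth fibrewise positive definite symmetric bilinear form on ${}^bTM$, $b$-forms of degree $k$ are the smooth sections of $\Lambda^k({}^bT^*M)$ (with the exterior derivative determined by the Lie bracket of $b$-vector fields), and a $b$-volume form is a nowhere vanishing section of $\Lambda^3({}^bT^*M)$. A $b$-vector field $X$ is a rotational Beltrami field for a $b$-metric $g$ and a $b$-volume form $\mu$ if, with $\alpha=g(X,\cdot)$, $$d\alpha=f\,\iota_X\mu,\qquad d\,\iota_X\mu=0$$ for some nowhere vanishing $f\in C^\infty(M)$. A Beltrami field on a $b$-manifold, even a compact one, need not have a periodic orbit in the complement of the critical hypersurface. Precisely: there exist a compact connected three-dimensional $b$-manifold $(M,Z)$ without boundary, with $Z\neq\emptyset$, a $b$-metric $g$ and a $b$-volume form $\mu$ on it, and a rotational Beltrami field $X$ for $(g,\mu)$ that is nowhere vanishing as a section of ${}^bTM$, such that $X$ has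 no (nonconstant) periodic orbit contained in $M\setminus Z$. -/

import Mathlib

open scoped Manifold ContDiff Topology

noncomputable section

namespace BGeometry

/-! ## Smooth functions and vector fields on a three-manifold -/

section VectorFields

/-- The ring `C^∞(M)` of smooth real functions on the three-manifold `M`. -/
abbrev Smooth (M : Type*) [TopologicalSpace M] [ChartedSpace (EuclideanSpace ℝ (Fin 3)) M] :
    Type _ :=
  C^∞⟮𝓡 3, M; 𝓘(ℝ, ℝ), ℝ⟯

/-- The smooth vector fields on the three-manifold `M`. -/
abbrev VField (M : Type*) [TopologicalSpace M] [ChartedSpace (EuclideanSpace ℝ (Fin 3)) M]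
    [IsManifold (𝓡 3) ∞ M] : Type _ :=
  Cₛ^∞⟮𝓡 3; EuclideanSpace ℝ (Fin 3), (TangentSpace (𝓡 3) : M → Type _)⟯

variable {M : Type*} [TopologicalSpace M] [ChartedSpace (EuclideanSpace ℝ (Fin 3)) M]
  [IsManifold (𝓡 3) ∞ M]

theorem contMDiff_mvfderiv {f : M → ℝ} (hf : ContMDiff (𝓡 3) 𝓘(ℝ, ℝ) ∞ f) (V : VField M) :
    ContMDiff (𝓡 3) 𝓘(ℝ, ℝ) ∞ (fun x => mvfderiv (𝓡 3) f x (V x)) := by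
  have h1 : ContMDiff (𝓡 3).tangent 𝓘(ℝ, ℝ).tangent ∞ (tangentMap (𝓡 3) 𝓘(ℝ, ℝ) f) :=
    hf.contMDiff_tangentMap (by rfl)
  exact (contMDiff_snd_tangentBundle_modelSpace (n := ∞) ℝ 𝓘(ℝ, ℝ)).comp (h1.comp V.contMDiff)

/-- The derivative `V f = df(V)` of a smooth function along a smooth vector field. -/
def along (V : VField M) (f : Smooth M) : Smooth M :=
  ⟨fun x => mvfderiv (𝓡 3) f x (V x), contMDiff_mvfderiv f.contMDiff V⟩

/-- The Lie bracket of two smooth vector fields. -/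
def bracket (V W : VField M) : VField M where
  toFun := VectorField.mlieBracket (𝓡 3) V W
  contMDiff_toFun := by
    have : IsManifold (𝓡 3) (((⊤ : ℕ∞) : WithTop ℕ∞) + 1) M := by
      simpa using (inferInstance : IsManifold (𝓡 3) ∞ M)
    have : IsManifold (𝓡 3) (minSmoothness ℝ 2) M := by
      simpa using (inferInstance : IsManifold (𝓡 3) 2 M)
    intro x
    exact ContMDiffAt.mlieBracket_vectorField (n := ⊤) (m := ⊤) (V.contMDiff x) (W.contMDiff x)
      (by simp)

/-- A vector field read in the chart at `x₀`. -/
def inChart (x₀ : M) (V : VField M) :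
    EuclideanSpace ℝ (Fin 3) → EuclideanSpace ℝ (Fin 3) :=
  VectorField.mpullbackWithin 𝓘(ℝ, EuclideanSpace ℝ (Fin 3)) (𝓡 3)
    (extChartAt (𝓡 3) x₀).symm V (Set.range (𝓡 3))

/-- The Lie bracket of vector fields acts on functions as the commutator. -/
theorem mvfderiv_bracket {f : M → ℝ} (hf : ContMDiff (𝓡 3) 𝓘(ℝ, ℝ) ∞ f) (V W : VField M) (x : M) :
    mvfderiv (𝓡 3) f x (bracket V W x) =
      mvfderiv (𝓡 3) (fun y => mvfderiv (𝓡 3) f y (W y)) x (V x) -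
        mvfderiv (𝓡 3) (fun y => mvfderiv (𝓡 3) f y (V y)) x (W x) := by
  set φ := extChartAt (𝓡 3) x with hφ
  let F : EuclideanSpace ℝ (Fin 3) → ℝ := f ∘ φ.symm
  have hrange : Set.range (𝓡 3) = Set.univ := ModelWithCorners.Boundaryless.range_eq_univ
  have hy0 : φ x ∈ φ.target := mem_extChartAt_target x
  have htgt : φ.target ∈ 𝓝 (φ x) := extChartAt_target_mem_nhds x
  have hsymm : φ.symm (φ x) = x := extChartAt_to_inv x
  have hopen : IsOpen φ.target := isOpen_extChartAt_target x
  have hψ : ∀ y ∈ φ.target, ContMDiffAt 𝓘(ℝ, EuclideanSpace ℝ (Fin 3)) (𝓡 3) ∞ φ.symm y :=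
    fun y hy => (contMDiffOn_extChartAt_symm x).contMDiffAt (hopen.mem_nhds hy)
  have hF : ContDiffAt ℝ ∞ F (φ x) := (hf.contMDiffAt.comp _ (hψ _ hy0)).contDiffAt
  have hdiff : ∀ U : VField M, DifferentiableAt ℝ (inChart x U) (φ x) := by
    intro U
    have h := VectorField.contMDiffWithinAt_mpullbackWithin_extChartAt_symm (n := ∞) (m := 1)
      ((U.contMDiff x).contMDiffWithinAt.of_le (by simp)) (s := Set.univ) uniqueMDiffOn_univ
      (Set.mem_univ x) (by norm_cast)
    have h2 := contMDiffWithinAt_vectorSpace_iff_contDiffWithinAt.1 h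
    rw [Set.preimage_univ, Set.inter_univ] at h2
    have h3 : ContDiffAt ℝ 1 (inChart x U) (φ x) := h2.contDiffAt htgt
    exact h3.differentiableAt (by simp)
  have chain : ∀ h : M → ℝ, ContMDiff (𝓡 3) 𝓘(ℝ, ℝ) ∞ h → ∀ y ∈ φ.target,
      ∀ v : EuclideanSpace ℝ (Fin 3), fderiv ℝ (h ∘ φ.symm) y v = mvfderiv (𝓡 3) h (φ.symm y)
        (mfderivWithin 𝓘(ℝ, EuclideanSpace ℝ (Fin 3)) (𝓡 3) φ.symm (Set.range (𝓡 3)) y v) := by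
    intro h hh y hy v
    rw [hrange, mfderivWithin_univ, ← mfderiv_eq_fderiv,
      mfderiv_comp y ((hh _).mdifferentiableAt (by simp)) ((hψ y hy).mdifferentiableAt (by simp))]
    rfl
  -- the derivative of `F` along the field read in the chart
  have key : ∀ U : VField M, ∀ y ∈ φ.target,
      fderiv ℝ F y (inChart x U y) = mvfderiv (𝓡 3) f (φ.symm y) (U (φ.symm y)) := by
    intro U y hy
    rw [chain f hf y hy, inChart, VectorField.mpullbackWithin_apply]
    obtain ⟨e, he⟩ := isInvertible_mfderivWithin_extChartAt_symm (I := 𝓡 3) hy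
    rw [← he, ContinuousLinearMap.inverse_equiv]
    exact congrArg (mvfderiv (𝓡 3) f (φ.symm y)) (e.apply_symm_apply (U (φ.symm y)))
  have second : ∀ U U' : VField M,
      mvfderiv (𝓡 3) (fun y => mvfderiv (𝓡 3) f y (U y)) x (U' x) =
        fderiv ℝ (fderiv ℝ F) (φ x) (inChart x U' (φ x)) (inChart x U (φ x)) +
          fderiv ℝ F (φ x) (fderiv ℝ (inChart x U) (φ x) (inChart x U' (φ x))) := by
    intro U U'
    have h1 := chain _ (contMDiff_mvfderiv hf U) (φ x) hy0 (inChart x U' (φ x))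
    have h2 : mfderivWithin 𝓘(ℝ, EuclideanSpace ℝ (Fin 3)) (𝓡 3) φ.symm (Set.range (𝓡 3)) (φ x)
        (inChart x U' (φ x)) = U' (φ.symm (φ x)) := by
      rw [inChart, VectorField.mpullbackWithin_apply]
      obtain ⟨e, he⟩ := isInvertible_mfderivWithin_extChartAt_symm (I := 𝓡 3) hy0
      rw [← he, ContinuousLinearMap.inverse_equiv]
      exact e.apply_symm_apply (U' (φ.symm (φ x)))
    rw [h2, hsymm] at h1
    rw [← h1]
    have h3 : ((fun y => mvfderiv (𝓡 3) f y (U y)) ∘ φ.symm) =ᶠ[𝓝 (φ x)]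
        fun y => fderiv ℝ F y (inChart x U y) := by
      filter_upwards [htgt] with y hy
      exact (key U y hy).symm
    rw [h3.fderiv_eq, fderiv_clm_apply
      ((hF.fderiv_right (m := 1) (by norm_cast)).differentiableAt (by simp)) (hdiff U)]
    simp [add_comm]
  have hlhs : mvfderiv (𝓡 3) f x (bracket V W x) =
      fderiv ℝ F (φ x) (VectorField.lieBracket ℝ (inChart x V) (inChart x W) (φ x)) := by
    obtain ⟨u, hu⟩ : ∃ u : EuclideanSpace ℝ (Fin 3),
      u = VectorField.lieBracket ℝ (inChart x V) (inChart x W) (φ x) := ⟨_, rfl⟩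
    have hu' : u = VectorField.lieBracketWithin ℝ (inChart x V) (inChart x W)
        ((extChartAt (𝓡 3) x).symm ⁻¹' Set.univ ∩ Set.range (𝓡 3)) (φ x) := by
      rw [hu, Set.preimage_univ, Set.univ_inter, hrange, VectorField.lieBracketWithin_univ]
    have hb : bracket V W x =
        (mfderiv (𝓡 3) 𝓘(ℝ, EuclideanSpace ℝ (Fin 3)) φ x).inverse u := by
      rw [hu']
      rfl
    rw [← hu, chain f hf _ hy0, hsymm, hb]
    refine congrArg (mvfderiv (𝓡 3) f x) ?_
    obtain ⟨e, he⟩ := isInvertible_mfderiv_extChartAt (I := 𝓡 3) (mem_extChartAt_source x)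
    have hcomp := mfderivWithin_extChartAt_symm_comp_mfderiv_extChartAt' (I := 𝓡 3)
      (mem_extChartAt_source (I := 𝓡 3) x)
    rw [← he] at hcomp
    rw [← he, ContinuousLinearMap.inverse_equiv]
    have h5 := congrArg (fun L => L (e.symm u)) hcomp
    have h6 : e (e.symm u) = u := e.apply_symm_apply u
    simp only [ContinuousLinearMap.comp_apply, ContinuousLinearEquiv.coe_coe] at h5
    rw [h6] at h5
    exact h5.symm
  have hsym : IsSymmSndFDerivAt ℝ F (φ x) := hF.isSymmSndFDerivAt (by simp; norm_cast)
  rw [hlhs, second, second, VectorField.lieBracket, map_sub, hsym.eq]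
  ring

/-- Smooth vector fields form a module over the ring of smooth functions. -/
instance : Module (Smooth M) (VField M) where
  smul f V := ⟨fun x => f x • V x, f.contMDiff.smul_section V.contMDiff⟩
  one_smul V := by ext x; exact one_smul ℝ (V x)
  mul_smul f h V := by ext x; exact mul_smul (f x) (h x) (V x)
  smul_zero f := by ext x; exact smul_zero (f x)
  smul_add f V W := by ext x; exact smul_add (f x) (V x) (W x)
  add_smul f h V := by ext x; exact add_smul (f x) (h x) (V x)
  zero_smul V := by ext x; exact zero_smul ℝ (V x)

end VectorFields

/-! ## b-manifolds of dimension three -/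

section BManifolds

variable {M : Type*} [TopologicalSpace M] [ChartedSpace (EuclideanSpace ℝ (Fin 3)) M]
  [IsManifold (𝓡 3) ∞ M]

/-- `Z` is a closed embedded hypersurface: near each of its points it is the zero set of a smooth
function whose differential does not vanish along `Z`. -/
def IsHypersurface (Z : Set M) : Prop :=
  IsClosed Z ∧ ∀ p ∈ Z, ∃ U : Set M, IsOpen U ∧ p ∈ U ∧ ∃ t : M → ℝ,
    ContMDiffOn (𝓡 3) 𝓘(ℝ, ℝ) ∞ t U ∧
    (∀ x ∈ U, x ∈ Z ↔ t x = 0) ∧ ∀ x ∈ U, x ∈ Z → mvfderiv (𝓡 3) t x ≠ 0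

/-- The tangent space `T_p Z` at a point `p` of `Z`, as a subspace of `T_p M`: the vectors that
annihilate every smooth function vanishing on `Z`. -/
def tangentTo (Z : Set M) (p : M) : Submodule ℝ (TangentSpace (𝓡 3) p) where
  carrier := {v | ∀ f : Smooth M, (∀ x ∈ Z, f x = 0) → mvfderiv (𝓡 3) f p v = 0}
  add_mem' hv hw f hf := by rw [map_add, hv f hf, hw f hf, add_zero]
  zero_mem' f _ := map_zero _
  smul_mem' c v hv f hf := by rw [map_smul, hv f hf, smul_zero]

/-- A b-manifold structure on the three-manifold `M`: an orientation of `M` together with an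
oriented hypersurface `Z`. Orientations are continuous choices of orientations of the tangent
spaces, continuity being expressed by local frames of smooth vector fields. -/
structure BManifold (M : Type*) [TopologicalSpace M] [ChartedSpace (EuclideanSpace ℝ (Fin 3)) M]
    [IsManifold (𝓡 3) ∞ M] where
  /-- the critical hypersurface -/
  Z : Set M
  isHypersurface : IsHypersurface Z
  /-- the orientation of `M` -/
  orient : ∀ x : M, Orientation ℝ (TangentSpace (𝓡 3) x) (Fin 3)
  orient_continuous : ∀ p : M, ∃ U ∈ 𝓝 p, ∃ Y : Fin 3 → VField M, ∀ x ∈ U,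
    ∃ b : Module.Basis (Fin 3) ℝ (TangentSpace (𝓡 3) x),
      (∀ i, b i = Y i x) ∧ b.orientation = orient x
  /-- the orientation of `Z` -/
  orientZ : ∀ z : Z, Orientation ℝ (tangentTo Z (z : M)) (Fin 2)
  orientZ_continuous : ∀ p : Z, ∃ U ∈ 𝓝 p, ∃ Y : Fin 2 → VField M, ∀ z ∈ U,
    ∃ b : Module.Basis (Fin 2) ℝ (tangentTo Z (z : M)),
      (∀ i, (b i : TangentSpace (𝓡 3) (z : M)) = Y i z) ∧ b.orientation = orientZ z

/-- The `C^∞(M)`-module of b-vector fields: the smooth vector fields tangent to `Z` along `Z`.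
These are the sections of the b-tangent bundle. -/
def bFields (Z : Set M) : Submodule (Smooth M) (VField M) where
  carrier := {V | ∀ p ∈ Z, V p ∈ tangentTo Z p}
  add_mem' hV hW p hp := (tangentTo Z p).add_mem (hV p hp) (hW p hp)
  zero_mem' p _ := (tangentTo Z p).zero_mem
  smul_mem' f _ hV p hp := (tangentTo Z p).smul_mem (f p) (hV p hp)

variable {Z : Set M}

/-- b-vector fields are closed under the Lie bracket. -/
def bBracket (V W : bFields Z) : bFields Z :=
  ⟨bracket V W, by
    intro p hp f hf
    rw [mvfderiv_bracket f.contMDiff]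
    have h1 := V.2 p hp (along W f) (fun x hx => W.2 x hx f hf)
    have h2 := W.2 p hp (along V f) (fun x hx => V.2 x hx f hf)
    exact (congrArg₂ (· - ·) h1 h2).trans (sub_zero 0)⟩

/-- `V` vanishes at `p` as a section of the b-tangent bundle. The fibre of that bundle at `p` is the
quotient of the module of b-vector fields by its multiples by functions vanishing at `p`. -/
def VanishesAt (V : bFields Z) (p : M) : Prop :=
  V ∈ (RingHom.ker (ContMDiffMap.evalRingHom p : Smooth M →+* ℝ) •
    ⊤ : Submodule (Smooth M) (bFields Z))

/-- The `k`-forms of the b-manifold, i.e. the smooth sections of the `k`-th exterior power of the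
b-cotangent bundle: the alternating `C^∞(M)`-multilinear forms on b-vector fields. -/
abbrev BForm (Z : Set M) (k : ℕ) : Type _ :=
  (bFields Z) [⋀^Fin k]→ₗ[Smooth M] Smooth M

/-- The exterior derivative of a b-form of degree one, evaluated on two b-vector fields. -/
def dOne (α : bFields Z →ₗ[Smooth M] Smooth M) (V W : bFields Z) : Smooth M :=
  along V (α W) - along W (α V) - α (bBracket V W)

/-- The exterior derivative of a b-form of degree two, evaluated on three b-vector fields. -/
def dTwo (β : BForm Z 2) (U V W : bFields Z) : Smooth M :=
  along U (β ![V, W]) - along V (β ![U, W]) + along W (β ![U, V])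
    - β ![bBracket U V, W] + β ![bBracket U W, V] - β ![bBracket V W, U]

/-- A b-metric: a smooth symmetric bilinear form on the b-tangent bundle, positive definite on
each fibre. -/
structure BMetric (Z : Set M) where
  form : bFields Z →ₗ[Smooth M] bFields Z →ₗ[Smooth M] Smooth M
  symm : ∀ V W, form V W = form W V
  pos : ∀ (V : bFields Z) (p : M), ¬ VanishesAt V p → 0 < form V V p

/-- A b-volume form: a b-form of top degree that vanishes nowhere as a section of the top exterior
power of the b-cotangent bundle. -/
def IsBVolume (μ : BForm Z 3) : Prop :=
  ∀ p : M, ∃ V : Fin 3 → bFields Z, μ V p ≠ 0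

/-- `X` is a rotational Beltrami field for the b-metric `g` and the b-volume form `μ`: with
`α = g(X, ·)`, one has `dα = f ι_X μ` for a nowhere vanishing smooth `f`, and `d ι_X μ = 0`. -/
def IsRotationalBeltrami (g : BMetric Z) (μ : BForm Z 3) (X : bFields Z) : Prop :=
  (∃ f : Smooth M, (∀ p, f p ≠ 0) ∧
    ∀ V W : bFields Z, dOne (g.form X) V W = f * μ.curryLeft X ![V, W]) ∧
  ∀ U V W : bFields Z, dTwo (μ.curryLeft X) U V W = 0

/-- `γ` is a periodic orbit of `X`: a nonconstant periodic integral curve. -/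
def IsPeriodicOrbit (X : VField M) (γ : ℝ → M) : Prop :=
  IsMIntegralCurve γ X ∧ (∃ T : ℝ, 0 < T ∧ Function.Periodic γ T) ∧ ∃ s t : ℝ, γ s ≠ γ t

end BManifolds

end BGeometry

end

/-!
The example is the unit sphere of `ℝ⁴`, with coordinates `(x, y, u, v)`, and `Z = {x = 0}`. The
b-symplectic form `ω = dx/x ∧ dy + du ∧ dv` has the Liouville field `x ∂x + y ∂y + (u ∂u + v ∂v) /
2`, which is transverse to the sphere. So the sphere carries the b-contact form `α = 2 dy - 2 y dx/x
+ u dv - v du`. Its Reeb direction is the direction of the Hamiltonian field `X = (-x y, x², -v, u)`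
of the squared norm. Along `X` the coordinate `y` has derivative `x²`, hence it strictly increases
along an orbit off `Z`, and no such orbit is periodic (`S3.not_isPeriodicOrbit`).

Sections of the b-tangent bundle are handled through a global frame. A smooth function vanishing on
`Z` is a smooth multiple of `x` (`S3.exists_eq_coord_mul`, from Hadamard's integral formula), so
`dx/x` is a form on b-vector fields; it is closed (`S3.dlog_bracket`). The gradients of `y, u, v` on
the sphere are then a frame of the b-tangent bundle, with dual coframe `θ₁ = dy - y dx/x`,
`θ₂ = du - u dx/x`, `θ₃ = dv - v dx/x` (`S3.eq_sum_coframe_smul_frame`). For the volume form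
`μ = θ₁ ∧ θ₂ ∧ θ₃` one has `ι_X μ = dx/x ∧ dy + du ∧ dv` (`S3.curryLeft_volume_beltrami`), which is
closed and equal to `dα / 2`. Since `α(X) = 1 + x² + y²` is positive, there is a b-metric with
`g(X, ·) = α` (`S3.metricForm`), and `X` is a Beltrami field with `f = 2`.
-/

namespace BGeometry

/-! ### Division by a linear coordinate -/

section Division

open MeasureTheory intervalIntegral

theorem continuousOn_integral_param {E F : Type} [NormedAddCommGroup E]
    [NormedAddCommGroup F] [NormedSpace ℝ F] {U : Set E} {G : E × ℝ → F}
    (hG : ContinuousOn G (U ×ˢ Set.univ)) :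
    ContinuousOn (fun q => ∫ s in (0 : ℝ)..1, G (q, s)) U := by
  rw [continuousOn_iff_continuous_domRestrict]
  refine continuous_parametric_intervalIntegral_of_continuous'
    (f := fun (q : U) (s : ℝ) => G (q, s)) ?_ 0 1
  exact hG.comp_continuous (f := fun z : U × ℝ => ((z.1 : E), z.2)) (by fun_prop)
    fun z => ⟨z.1.2, Set.mem_univ _⟩

/-- Differentiation under the integral sign over a compact interval. -/
theorem hasFDerivAt_integral_param {E F : Type} [NormedAddCommGroup E] [NormedSpace ℝ E]
    [FiniteDimensional ℝ E] [NormedAddCommGroup F] [NormedSpace ℝ F] {U : Set E} (hU : IsOpen U)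
    {G : E × ℝ → F} (hG : ContDiffOn ℝ 1 G (U ×ˢ Set.univ)) {q : E} (hq : q ∈ U) :
    HasFDerivAt (fun q => ∫ s in (0 : ℝ)..1, G (q, s))
      (∫ s in (0 : ℝ)..1, (fderiv ℝ G (q, s)).comp (ContinuousLinearMap.inl ℝ E ℝ)) q := by
  have hUo : IsOpen (U ×ˢ (Set.univ : Set ℝ)) := hU.prod isOpen_univ
  have hG' : ContinuousOn (fun z : E × ℝ => (fderiv ℝ G z).comp (ContinuousLinearMap.inl ℝ E ℝ))
      (U ×ˢ Set.univ) :=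
    (hG.continuousOn_fderiv_of_isOpen hUo (by norm_num)).clm_comp continuousOn_const
  have hline : ∀ {H : Type} [NormedAddCommGroup H] {K : E × ℝ → H},
      ContinuousOn K (U ×ˢ Set.univ) → ∀ x ∈ U, Continuous fun s : ℝ => K (x, s) :=
    fun hK x hx => hK.comp_continuous (by fun_prop) fun s => ⟨hx, Set.mem_univ _⟩
  obtain ⟨ε, hε, hball⟩ := Metric.nhds_basis_closedBall.mem_iff.1 (hU.mem_nhds hq)
  have hK : IsCompact (Metric.closedBall q ε ×ˢ Set.Icc (0 : ℝ) 1) :=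
    (isCompact_closedBall q ε).prod isCompact_Icc
  obtain ⟨C, hC⟩ := hK.exists_bound_of_continuousOn
    (hG'.mono (Set.prod_mono hball (Set.subset_univ _)))
  refine hasFDerivAt_integral_of_dominated_of_fderiv_le (F := fun q s => G (q, s))
    (F' := fun q s => (fderiv ℝ G (q, s)).comp (ContinuousLinearMap.inl ℝ E ℝ))
    (bound := fun _ => C)
    (Metric.closedBall_mem_nhds q hε) ?_ ((hline hG.continuousOn q hq).intervalIntegrable _ _)
    (hline hG' q hq).aestronglyMeasurable ?_ intervalIntegrable_const ?_
  · filter_upwards [hU.mem_nhds hq] with x hx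
    exact (hline hG.continuousOn x hx).aestronglyMeasurable
  · refine Filter.Eventually.of_forall fun s hs x hx => hC (x, s) ⟨hx, ?_⟩
    rw [Set.uIoc_of_le zero_le_one] at hs
    exact ⟨hs.1.le, hs.2⟩
  · refine Filter.Eventually.of_forall fun s _ x hx => ?_
    have h1 : HasFDerivAt G (fderiv ℝ G (x, s)) (x, s) :=
      ((hG.contDiffAt (hUo.mem_nhds ⟨hball hx, Set.mem_univ s⟩)).differentiableAt
        (by norm_num)).hasFDerivAt
    exact h1.comp x (hasFDerivAt_prodMk_left x s)

theorem contDiffOn_integral_param {E : Type} [NormedAddCommGroup E] [NormedSpace ℝ E]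
    [FiniteDimensional ℝ E] {U : Set E} (hU : IsOpen U) (n : ℕ) :
    ∀ {F : Type} [NormedAddCommGroup F] [NormedSpace ℝ F] {G : E × ℝ → F},
      ContDiffOn ℝ n G (U ×ˢ Set.univ) →
      ContDiffOn ℝ n (fun q => ∫ s in (0 : ℝ)..1, G (q, s)) U := by
  induction n with
  | zero =>
    intro F _ _ G hG
    exact contDiffOn_zero.2 (continuousOn_integral_param (contDiffOn_zero.1 hG))
  | succ n ih =>
    intro F _ _ G hG
    have hUo : IsOpen (U ×ˢ (Set.univ : Set ℝ)) := hU.prod isOpen_univ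
    have hG1 : ContDiffOn ℝ 1 G (U ×ˢ Set.univ) := hG.of_le (by norm_cast; omega)
    have hd := fun q hq => hasFDerivAt_integral_param hU hG1 (q := q) hq
    push_cast
    refine (contDiffOn_succ_iff_fderiv_of_isOpen hU).2
      ⟨fun q hq => (hd q hq).differentiableAt.differentiableWithinAt, by simp, ?_⟩
    refine (ih (G := fun z => (fderiv ℝ G z).comp (ContinuousLinearMap.inl ℝ E ℝ)) ?_).congr
      fun q hq => (hd q hq).fderiv
    exact (hG.fderiv_of_isOpen hUo (by norm_cast)).clm_comp contDiffOn_const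

/-- Hadamard's lemma: a smooth function vanishing on the kernel of a linear form is a smooth
multiple of that form, on any open set that is a union of lines transverse to the kernel. -/
theorem exists_contDiffOn_eq_mul_of_eq_zero {E : Type} [NormedAddCommGroup E] [NormedSpace ℝ E]
    [FiniteDimensional ℝ E] {U : Set E} (hU : IsOpen U) (ℓ : E →L[ℝ] ℝ) {e : E} (he : ℓ e = 1)
    (hUe : ∀ q ∈ U, ∀ t : ℝ, q + t • e ∈ U) {f : E → ℝ} (hf : ContDiffOn ℝ ∞ f U)
    (hf0 : ∀ q ∈ U, ℓ q = 0 → f q = 0) :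
    ∃ h : E → ℝ, ContDiffOn ℝ ∞ h U ∧ ∀ q ∈ U, f q = ℓ q * h q := by
  refine ⟨fun q => ∫ s in (0 : ℝ)..1, fderiv ℝ f (q + ((s - 1) * ℓ q) • e) e, ?_, ?_⟩
  · refine contDiffOn_infty.2 fun n => contDiffOn_integral_param hU n
      (G := fun z => fderiv ℝ f (z.1 + ((z.2 - 1) * ℓ z.1) • e) e) ?_
    have h1 : ContDiffOn ℝ ∞ (fderiv ℝ f) U := hf.fderiv_of_isOpen hU (by simp)
    have h2 : ContDiff ℝ ∞ fun z : E × ℝ => z.1 + ((z.2 - 1) * ℓ z.1) • e := by fun_prop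
    exact ((h1.comp h2.contDiffOn fun z hz => hUe _ hz.1 _).clm_apply contDiffOn_const).of_le
      (by exact_mod_cast le_top)
  · intro q hq
    have hd : ∀ s : ℝ, HasDerivAt (fun s : ℝ => f (q + ((s - 1) * ℓ q) • e))
        (ℓ q * fderiv ℝ f (q + ((s - 1) * ℓ q) • e) e) s := by
      intro s
      have h1 : HasFDerivAt f (fderiv ℝ f (q + ((s - 1) * ℓ q) • e)) (q + ((s - 1) * ℓ q) • e) :=
        ((hf.contDiffAt (hU.mem_nhds (hUe q hq _))).differentiableAt (by simp)).hasFDerivAt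
      have h2 : HasDerivAt (fun s : ℝ => q + ((s - 1) * ℓ q) • e) (ℓ q • e) s := by
        have := ((((hasDerivAt_id s).sub_const 1).mul_const (ℓ q)).smul_const e).const_add q
        simpa using this
      exact (h1.comp_hasDerivAt s h2).congr_deriv (by simp)
    have hc : Continuous fun s : ℝ => ℓ q * fderiv ℝ f (q + ((s - 1) * ℓ q) • e) e := by
      have h1 : ContinuousOn (fderiv ℝ f) U := 
        (hf.fderiv_of_isOpen hU (m := ∞) (by simp)).continuousOn
      have h2 : Continuous fun s : ℝ => fderiv ℝ f (q + ((s - 1) * ℓ q) • e) :=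
        h1.comp_continuous (by fun_prop) fun s => hUe q hq _
      fun_prop
    have h := integral_eq_sub_of_hasDerivAt (fun s _ => hd s) (hc.intervalIntegrable 0 1)
    rw [intervalIntegral.integral_const_mul] at h
    rw [h]
    have h0 : f (q + ((0 - 1) * ℓ q) • e) = 0 := hf0 _ (hUe q hq _) (by simp [he])
    rw [h0]
    simp

end Division

/-! ### Derivatives along vector fields -/

section Along

variable {M : Type*} [TopologicalSpace M] [ChartedSpace (EuclideanSpace ℝ (Fin 3)) M]
  [IsManifold (𝓡 3) ∞ M]

theorem along_apply (V : VField M) (f : Smooth M) (p : M) :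
    along V f p = mvfderiv (𝓡 3) f p (V p) := rfl

theorem along_add (V : VField M) (f h : Smooth M) : along V (f + h) = along V f + along V h := by
  ext p
  exact congrArg (fun L => L (V p)) (mvfderiv_add (f.contMDiff.mdifferentiableAt (x := p) (by simp))
    (h.contMDiff.mdifferentiableAt (by simp)))

theorem along_mul (V : VField M) (f h : Smooth M) :
    along V (f * h) = f * along V h + along V f * h := by
  ext p
  refine (congrArg (fun L => L (V p))
    (mvfderiv_mul (f.contMDiff.mdifferentiableAt (x := p) (by simp))
    (h.contMDiff.mdifferentiableAt (by simp)))).trans ?_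
  simp [along_apply, mul_comm]

theorem along_zero (V : VField M) : along V 0 = 0 := by
  simpa using along_add V 0 0

theorem along_one (V : VField M) : along V 1 = 0 := by
  simpa using along_mul V 1 1

theorem along_neg (V : VField M) (f : Smooth M) : along V (-f) = -along V f := by
  rw [eq_neg_iff_add_eq_zero, ← along_add, neg_add_cancel, along_zero]

theorem along_sub (V : VField M) (f h : Smooth M) : along V (f - h) = along V f - along V h := by
  rw [sub_eq_add_neg, along_add, along_neg, sub_eq_add_neg]

theorem along_two (V : VField M) : along V 2 = 0 := by
  rw [← one_add_one_eq_two, along_add, along_one, add_zero]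

theorem along_add_field (V W : VField M) (f : Smooth M) :
    along (V + W) f = along V f + along W f := by
  ext p
  exact map_add (mvfderiv (𝓡 3) f p) (V p) (W p)

theorem along_smul_field (h : Smooth M) (V : VField M) (f : Smooth M) :
    along (h • V) f = h * along V f := by
  ext p
  exact map_smul (mvfderiv (𝓡 3) f p) (h p) (V p)

theorem along_bracket (V W : VField M) (f : Smooth M) :
    along (bracket V W) f = along V (along W f) - along W (along V f) := by
  ext p
  exact mvfderiv_bracket f.contMDiff V W p

end Along

/-! ### The three-sphere -/

/-- The unit sphere of `ℝ⁴`. -/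
abbrev S3 : Type := Metric.sphere (0 : EuclideanSpace ℝ (Fin 4)) 1

instance : Fact (Module.finrank ℝ (EuclideanSpace ℝ (Fin 4)) = 3 + 1) :=
  ⟨finrank_euclideanSpace_fin⟩

namespace S3

noncomputable section

/-- The coordinate functions of `ℝ⁴`, restricted to the sphere. -/
def coord (i : Fin 4) : Smooth S3 :=
  ⟨fun p => (p : EuclideanSpace ℝ (Fin 4)) i,
    (EuclideanSpace.proj (𝕜 := ℝ) i).contMDiff.comp contMDiff_coe_sphere⟩

theorem coord_apply (i : Fin 4) (p : S3) : coord i p = (p : EuclideanSpace ℝ (Fin 4)) i := rfl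

theorem sum_coord_sq (p : S3) :
    coord 0 p ^ 2 + coord 1 p ^ 2 + coord 2 p ^ 2 + coord 3 p ^ 2 = 1 := by
  have h := EuclideanSpace.real_norm_sq_eq (p : EuclideanSpace ℝ (Fin 4))
  rw [norm_eq_of_mem_sphere p, Fin.sum_univ_four] at h
  simpa [coord_apply] using h.symm

theorem mvfderiv_coord (i : Fin 4) (p : S3) (v : TangentSpace (𝓡 3) p) :
    mvfderiv (𝓡 3) (coord i) p v =
      mvfderiv (𝓡 3) ((↑) : S3 → EuclideanSpace ℝ (Fin 4)) p v i := by
  have h1 : MDifferentiableAt (𝓡 3) 𝓘(ℝ, EuclideanSpace ℝ (Fin 4))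
      ((↑) : S3 → EuclideanSpace ℝ (Fin 4)) p :=
    (contMDiff_coe_sphere (m := 1) p).mdifferentiableAt (by simp)
  have h2 : MDifferentiableAt 𝓘(ℝ, EuclideanSpace ℝ (Fin 4)) 𝓘(ℝ, ℝ)
      (EuclideanSpace.proj (𝕜 := ℝ) i : EuclideanSpace ℝ (Fin 4) → ℝ) p :=
    (EuclideanSpace.proj (𝕜 := ℝ) i).mdifferentiableAt
  have h := mvfderiv_comp_apply (I := 𝓘(ℝ, EuclideanSpace ℝ (Fin 4))) (I' := 𝓡 3)
    (f := ((↑) : S3 → EuclideanSpace ℝ (Fin 4)))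
    (g := (EuclideanSpace.proj (𝕜 := ℝ) i : EuclideanSpace ℝ (Fin 4) → ℝ)) p h2 h1 v
  refine h.trans ?_
  rw [mvfderiv, ContinuousLinearMap.mfderiv_eq]
  rfl

/-- A tangent vector of the sphere is determined by its action on the coordinates. -/
theorem tangent_ext {p : S3} {v w : TangentSpace (𝓡 3) p}
    (h : ∀ i, mvfderiv (𝓡 3) (coord i) p v = mvfderiv (𝓡 3) (coord i) p w) : v = w := by
  apply injective_mvfderiv_subtypeVal_sphere p
  ext i
  simpa only [mvfderiv_coord] using h i

theorem field_ext {V W : VField S3} (h : ∀ i, along V (coord i) = along W (coord i)) : V = W := by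
  ext1 p
  exact tangent_ext fun i => congrArg (fun f : Smooth S3 => f p) (h i)

/-- Differentiating `∑ cᵢ² = 1`. -/
theorem sum_coord_mul_mvfderiv (p : S3) (v : TangentSpace (𝓡 3) p) :
    ∑ i, coord i p * mvfderiv (𝓡 3) (coord i) p v = 0 := by
  have h : mvfderiv (𝓡 3) ((↑) : S3 → EuclideanSpace ℝ (Fin 4)) p v ∈
      (Submodule.span ℝ {(p : EuclideanSpace ℝ (Fin 4))})ᗮ := by
    rw [← range_mvfderiv_subtypeVal (n := 3)]
    exact ⟨v, rfl⟩
  rw [Submodule.mem_orthogonal_singleton_iff_inner_right] at h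
  simp only [mvfderiv_coord, coord_apply]
  simpa [PiLp.inner_apply, mul_comm] using h

section OfAmbient

theorem contMDiff_normalize {N : Type*} {H E : Type*} [NormedAddCommGroup E] [NormedSpace ℝ E]
    [TopologicalSpace H] {I : ModelWithCorners ℝ E H} [TopologicalSpace N] [ChartedSpace H N]
    {f : N → EuclideanSpace ℝ (Fin 4)}
    (hf : ContMDiff I 𝓘(ℝ, EuclideanSpace ℝ (Fin 4)) ∞ f) (h0 : ∀ x, f x ≠ 0) :
    ContMDiff I 𝓘(ℝ, EuclideanSpace ℝ (Fin 4)) ∞ fun x => ‖f x‖⁻¹ • f x := by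
  intro x
  have h : ContDiffAt ℝ ∞ (fun q : EuclideanSpace ℝ (Fin 4) => ‖q‖⁻¹ • q) (f x) :=
    ((contDiffAt_norm ℝ (h0 x)).inv (norm_ne_zero_iff.2 (h0 x))).smul contDiffAt_id
  exact h.contMDiffAt.comp x (hf x)

theorem norm_sq_add_smul {p w : EuclideanSpace ℝ (Fin 4)} (hp : ‖p‖ = 1) (hw : inner ℝ p w = 0)
    (t : ℝ) : ‖p + t • w‖ ^ 2 = 1 + t ^ 2 * ‖w‖ ^ 2 := by
  rw [norm_add_sq_real, inner_smul_right, hw, hp, norm_smul, mul_pow]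
  simp

theorem add_smul_ne_zero {p w : EuclideanSpace ℝ (Fin 4)} (hp : ‖p‖ = 1) (hw : inner ℝ p w = 0)
    (t : ℝ) : p + t • w ≠ 0 := by
  intro h
  have h1 := norm_sq_add_smul hp hw t
  rw [h, norm_zero] at h1
  have : 0 ≤ t ^ 2 * ‖w‖ ^ 2 := by positivity
  linarith

theorem hasDerivAt_normalize_add_smul {p w : EuclideanSpace ℝ (Fin 4)} (hp : ‖p‖ = 1)
    (hw : inner ℝ p w = 0) :
    HasDerivAt (fun t : ℝ => ‖p + t • w‖⁻¹ • (p + t • w)) w 0 := by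
  have h1 : (fun t : ℝ => ‖p + t • w‖) = fun t => Real.sqrt (1 + t ^ 2 * ‖w‖ ^ 2) := by
    ext t
    rw [← norm_sq_add_smul hp hw t, Real.sqrt_sq (norm_nonneg _)]
  have h2 : HasDerivAt (fun t : ℝ => ‖p + t • w‖) 0 0 := by
    rw [h1]
    have h3 := (((hasDerivAt_id (0 : ℝ)).pow 2).mul_const (‖w‖ ^ 2)).const_add 1
    exact (h3.sqrt (by simp)).congr_deriv (by simp)
  have h3 : HasDerivAt (fun t : ℝ => p + t • w) w 0 :=
    (((hasDerivAt_id (0 : ℝ)).smul_const w).const_add p).congr_deriv (by simp)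
  exact ((h2.inv (by simp [hp])).smul h3).congr_deriv (by simp [hp])

/-- The map `(t, p) ↦ (p + t w(p)) / ‖p + t w(p)‖`, for a field `w` of vectors of `ℝ⁴` tangent to
the sphere: a variation of the identity of the sphere with initial velocity `w`. -/
def push (w : S3 → EuclideanSpace ℝ (Fin 4))
    (ht : ∀ p : S3, inner ℝ (p : EuclideanSpace ℝ (Fin 4)) (w p) = 0) : ℝ × S3 → S3 :=
  Set.codRestrict
    (fun z => ‖(z.2 : EuclideanSpace ℝ (Fin 4)) + z.1 • w z.2‖⁻¹ • (z.2 + z.1 • w z.2)) _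
    fun z => by
      have h0 := add_smul_ne_zero (norm_eq_of_mem_sphere z.2) (ht z.2) z.1
      rw [mem_sphere_zero_iff_norm, norm_smul, norm_inv, norm_norm,
        inv_mul_cancel₀ (norm_ne_zero_iff.2 h0)]

theorem contMDiff_push {w : S3 → EuclideanSpace ℝ (Fin 4)}
    (hw : ContMDiff (𝓡 3) 𝓘(ℝ, EuclideanSpace ℝ (Fin 4)) ∞ w)
    (ht : ∀ p : S3, inner ℝ (p : EuclideanSpace ℝ (Fin 4)) (w p) = 0) :
    ContMDiff (𝓘(ℝ, ℝ).prod (𝓡 3)) (𝓡 3) ∞ (push w ht) := by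
  refine ContMDiff.codRestrict_sphere ?_ _
  refine contMDiff_normalize ?_ fun z =>
    add_smul_ne_zero (norm_eq_of_mem_sphere z.2) (ht z.2) z.1
  exact (contMDiff_coe_sphere.comp contMDiff_snd).add (contMDiff_fst.smul (hw.comp contMDiff_snd))

theorem push_zero (w : S3 → EuclideanSpace ℝ (Fin 4))
    (ht : ∀ p : S3, inner ℝ (p : EuclideanSpace ℝ (Fin 4)) (w p) = 0) (p : S3) :
    push w ht (0, p) = p := by
  apply Subtype.ext
  simp [push]

/-- The vector field on the sphere given by a smooth field `w` of vectors of `ℝ⁴` tangent to the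
sphere. It is obtained as the initial velocity of the variation `push w`, which makes its smoothness
a consequence of that of the tangent map. -/
def ofAmbient (w : S3 → EuclideanSpace ℝ (Fin 4))
    (hw : ContMDiff (𝓡 3) 𝓘(ℝ, EuclideanSpace ℝ (Fin 4)) ∞ w)
    (ht : ∀ p : S3, inner ℝ (p : EuclideanSpace ℝ (Fin 4)) (w p) = 0) : VField S3 where
  toFun p := mfderiv (𝓘(ℝ, ℝ).prod (𝓡 3)) (𝓡 3) (push w ht) (0, p)
    ((1 : ℝ), (0 : EuclideanSpace ℝ (Fin 3)))
  contMDiff_toFun := by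
    have h1 : ContMDiff (𝓡 3) (𝓡 3).tangent ∞
        fun p : S3 => (Bundle.TotalSpace.mk' (EuclideanSpace ℝ (Fin 3)) p 0 :
          TangentBundle (𝓡 3) S3) := Bundle.contMDiff_zeroSection _ _
    have h2 : ContMDiff (𝓡 3) 𝓘(ℝ, ℝ).tangent ∞
        fun _ : S3 => (Bundle.TotalSpace.mk' ℝ (0 : ℝ) (1 : ℝ) : TangentBundle 𝓘(ℝ, ℝ) ℝ) :=
      contMDiff_const
    have h3 := ((contMDiff_push hw ht).contMDiff_tangentMap (m := ∞) (by simp)).comp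
      (contMDiff_equivTangentBundleProd_symm.comp (h2.prodMk h1))
    convert! h3 using 2 with p
    have h4 : ∀ (q : S3) (v : EuclideanSpace ℝ (Fin 3)), q = p →
        (⟨p, v⟩ : TangentBundle (𝓡 3) S3) = ⟨q, v⟩ := by
      rintro q v rfl
      rfl
    exact h4 _ _ (push_zero w ht p)

theorem mvfderiv_coord_ofAmbient (w : S3 → EuclideanSpace ℝ (Fin 4))
    (hw : ContMDiff (𝓡 3) 𝓘(ℝ, EuclideanSpace ℝ (Fin 4)) ∞ w)
    (ht : ∀ p : S3, inner ℝ (p : EuclideanSpace ℝ (Fin 4)) (w p) = 0) (i : Fin 4) (p : S3) :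
    mvfderiv (𝓡 3) (coord i) p (ofAmbient w hw ht p) = w p i := by
  have hc : MDifferentiableAt (𝓡 3) 𝓘(ℝ, ℝ) (coord i) p :=
    (coord i).contMDiff.mdifferentiableAt (by simp)
  have hP : MDifferentiableAt (𝓘(ℝ, ℝ).prod (𝓡 3)) (𝓡 3) (push w ht) ((0 : ℝ), p) :=
    (contMDiff_push hw ht).mdifferentiableAt (by simp)
  have hl : MDifferentiableAt 𝓘(ℝ, ℝ) (𝓘(ℝ, ℝ).prod (𝓡 3)) (fun t : ℝ => (t, p)) 0 :=
    mdifferentiableAt_id.prodMk mdifferentiableAt_const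
  have h1 := mvfderiv_comp_apply_of_eq (I := 𝓡 3) (I' := 𝓘(ℝ, ℝ).prod (𝓡 3)) ((0 : ℝ), p) hc hP
    (push_zero w ht p) ((1 : ℝ), (0 : EuclideanSpace ℝ (Fin 3)))
  have hcP : MDifferentiableAt (𝓘(ℝ, ℝ).prod (𝓡 3)) 𝓘(ℝ, ℝ) (coord i ∘ push w ht) ((0 : ℝ), p) :=
    (((coord i).contMDiff.comp (contMDiff_push hw ht)).mdifferentiableAt (by simp))
  have h2 := mvfderiv_comp_apply (I := 𝓘(ℝ, ℝ).prod (𝓡 3)) (I' := 𝓘(ℝ, ℝ)) (0 : ℝ) hcP hl (1 : ℝ)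
  have h3 : HasDerivAt ((coord i ∘ push w ht) ∘ fun t : ℝ => (t, p)) (w p i) 0 :=
    (EuclideanSpace.proj (𝕜 := ℝ) i).hasFDerivAt.comp_hasDerivAt (0 : ℝ)
      (hasDerivAt_normalize_add_smul (norm_eq_of_mem_sphere p) (ht p))
  refine h1.symm.trans ?_
  rw [mfderiv_prod_left] at h2
  refine h2.symm.trans ?_
  rw [mvfderiv, mfderiv_eq_fderiv]
  refine Eq.trans ?_ h3.deriv
  rw [← fderiv_apply_one_eq_deriv]
  rfl

end OfAmbient

/-! ### Functions vanishing on the equator -/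

/-- The degree zero homogeneous extension to `ℝ⁴ ∖ {0}` of a smooth function on the sphere. -/
theorem exists_homogeneous_extension (f : Smooth S3) :
    ∃ F : EuclideanSpace ℝ (Fin 4) → ℝ, ContDiffOn ℝ ∞ F {q | q ≠ 0} ∧
      (∀ q ≠ 0, ∃ p : S3, (p : EuclideanSpace ℝ (Fin 4)) = ‖q‖⁻¹ • q ∧ F q = f p) ∧
      ∀ p : S3, F p = f p := by
  classical
  have hmem : ∀ q : EuclideanSpace ℝ (Fin 4), q ≠ 0 →
      ‖q‖⁻¹ • q ∈ Metric.sphere (0 : EuclideanSpace ℝ (Fin 4)) 1 := fun q hq => by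
    rw [mem_sphere_zero_iff_norm, norm_smul, norm_inv, norm_norm,
      inv_mul_cancel₀ (norm_ne_zero_iff.2 hq)]
  let F : EuclideanSpace ℝ (Fin 4) → ℝ := fun q =>
    if hq : q ≠ 0 then f ⟨‖q‖⁻¹ • q, hmem q hq⟩ else 0
  have hF : ∀ q (hq : q ≠ 0), F q = f ⟨‖q‖⁻¹ • q, hmem q hq⟩ := fun q hq => dif_pos hq
  refine ⟨F, fun q hq => ?_, fun q hq => ⟨⟨_, hmem q hq⟩, rfl, hF q hq⟩, fun p => ?_⟩
  · let W : TopologicalSpace.Opens (EuclideanSpace ℝ (Fin 4)) := ⟨{q | q ≠ 0}, isOpen_ne⟩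
    have h1 : ContMDiff 𝓘(ℝ, EuclideanSpace ℝ (Fin 4)) 𝓘(ℝ, EuclideanSpace ℝ (Fin 4)) ∞
        fun q : W => ‖(q : EuclideanSpace ℝ (Fin 4))‖⁻¹ • (q : EuclideanSpace ℝ (Fin 4)) :=
      contMDiff_normalize contMDiff_subtype_val fun q => q.2
    have h2 := f.contMDiff.comp (h1.codRestrict_sphere (n := 3) fun q => hmem q q.2)
    have h3 : ContMDiff 𝓘(ℝ, EuclideanSpace ℝ (Fin 4)) 𝓘(ℝ, ℝ) ∞
        fun q : W => F (q : EuclideanSpace ℝ (Fin 4)) := by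
      convert h2 using 2 with q
      exact hF q q.2
    have h4 := contMDiffAt_subtype_iff.1 (h3 ⟨q, hq⟩)
    exact h4.contDiffAt.contDiffWithinAt
  · have hp : (p : EuclideanSpace ℝ (Fin 4)) ≠ 0 := ne_zero_of_mem_unit_sphere p
    rw [hF _ hp]
    congr 1
    apply Subtype.ext
    simp

/-- The linear projection of `ℝ⁴` killing the first basis vector. -/
def dropFirst : EuclideanSpace ℝ (Fin 4) →L[ℝ] EuclideanSpace ℝ (Fin 4) :=
  ContinuousLinearMap.id ℝ _ -
    (EuclideanSpace.proj (𝕜 := ℝ) (0 : Fin 4)).smulRight (EuclideanSpace.single 0 1)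

theorem dropFirst_apply (q : EuclideanSpace ℝ (Fin 4)) :
    dropFirst q = q - q 0 • EuclideanSpace.single 0 1 := rfl

/-- Hadamard's lemma on the sphere: a smooth function vanishing on the equator is divisible by the
first coordinate. -/
theorem exists_eq_coord_mul (f : Smooth S3) (hf : ∀ p, coord 0 p = 0 → f p = 0) :
    ∃ h : Smooth S3, f = coord 0 * h := by
  classical
  obtain ⟨F, hF, hF1, hF2⟩ := exists_homogeneous_extension f
  let U : Set (EuclideanSpace ℝ (Fin 4)) := {q | dropFirst q ≠ 0}
  have hU : IsOpen U := isOpen_ne_fun dropFirst.continuous continuous_const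
  have hU0 : ∀ q ∈ U, q ≠ 0 := by
    rintro q hq rfl
    exact hq (map_zero _)
  obtain ⟨k, hk, hFk⟩ := exists_contDiffOn_eq_mul_of_eq_zero hU
    (EuclideanSpace.proj (𝕜 := ℝ) (0 : Fin 4)) (e := EuclideanSpace.single 0 1) (by simp)
    (fun q hq t => by
      have he : dropFirst (EuclideanSpace.single 0 1) = 0 := by simp [dropFirst_apply]
      simpa [U, he] using hq)
    (hF.mono hU0) fun q hq hq0 => by
      obtain ⟨p, hp, hFp⟩ := hF1 q (hU0 q hq)
      rw [hFp]
      refine hf p ?_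
      rw [coord_apply, hp]
      simpa using Or.inr hq0
  have hfk : ∀ p : S3, (p : EuclideanSpace ℝ (Fin 4)) ∈ U → f p = coord 0 p * k p :=
    fun p hp => by rw [← hF2 p, hFk _ hp]; rfl
  have hUZ : ∀ p : S3, coord 0 p = 0 → (p : EuclideanSpace ℝ (Fin 4)) ∈ U := by
    intro p hp h
    rw [dropFirst_apply, ← coord_apply, hp, zero_smul, sub_zero] at h
    exact ne_zero_of_mem_unit_sphere p h
  let h : S3 → ℝ := fun p => if coord 0 p = 0 then k p else f p / coord 0 p
  have hh : ContMDiff (𝓡 3) 𝓘(ℝ, ℝ) ∞ h := by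
    intro p
    by_cases hp : coord 0 p = 0
    · have h1 : h =ᶠ[𝓝 p] k ∘ ((↑) : S3 → EuclideanSpace ℝ (Fin 4)) := by
        filter_upwards [(hU.preimage continuous_subtype_val).mem_nhds (hUZ p hp)] with x hx
        by_cases hx0 : coord 0 x = 0
        · exact if_pos hx0
        · refine (if_neg hx0).trans ?_
          rw [hfk x hx, mul_div_cancel_left₀ _ hx0]
          rfl
      have h2 : ContDiffAt ℝ ∞ k p := hk.contDiffAt (hU.mem_nhds (hUZ p hp))
      exact (h2.contMDiffAt.comp p (contMDiff_coe_sphere p)).congr_of_eventuallyEq h1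
    · have h1 : h =ᶠ[𝓝 p] fun x => f x / coord 0 x := by
        filter_upwards [(coord 0).contMDiff.continuous.continuousAt.eventually_ne hp] with x hx
        exact if_neg hx
      exact ((f.contMDiff p).div₀ ((coord 0).contMDiff p) hp).congr_of_eventuallyEq h1
  refine ⟨⟨h, hh⟩, ?_⟩
  ext p
  change f p = coord 0 p * (if coord 0 p = 0 then k p else f p / coord 0 p)
  split_ifs with hp
  · rw [hf p hp, hp, zero_mul]
  · rw [mul_div_cancel₀ _ hp]

/-- The projections to the tangent spaces of the sphere of the basis vectors of `ℝ⁴`, that is, the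
gradients of the coordinates. -/
def grad (i : Fin 4) : VField S3 :=
  ofAmbient (fun p => EuclideanSpace.single i 1 - coord i p • (p : EuclideanSpace ℝ (Fin 4)))
    (contMDiff_const.sub ((coord i).contMDiff.smul contMDiff_coe_sphere)) fun p => by
      rw [inner_sub_right, inner_smul_right, real_inner_self_eq_norm_sq, norm_eq_of_mem_sphere p,
        EuclideanSpace.inner_single_right]
      simp [coord_apply]

theorem mvfderiv_coord_grad (i j : Fin 4) (p : S3) :
    mvfderiv (𝓡 3) (coord j) p (grad i p) = (if j = i then 1 else 0) - coord i p * coord j p := by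
  rw [grad, mvfderiv_coord_ofAmbient]
  simp [coord_apply]

/-- The first coordinate is not a zero divisor, as its zero set has empty interior. -/
theorem eq_zero_of_coord_mul_eq_zero {f : Smooth S3} (h : coord 0 * f = 0) : f = 0 := by
  have h0 : ∀ p, coord 0 p * f p = 0 := fun p => congrArg (fun f : Smooth S3 => f p) h
  ext p
  by_cases hp : coord 0 p = 0
  · have h1 := along_mul (grad 0) (coord 0) f
    rw [h, along_zero] at h1
    have h2 : 0 = coord 0 p * along (grad 0) f p + along (grad 0) (coord 0) p * f p :=
      congrArg (fun f : Smooth S3 => f p) h1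
    rw [along_apply (grad 0) (coord 0), mvfderiv_coord_grad, hp] at h2
    simpa using h2.symm
  · simpa [hp] using h0 p

/-! ### The b-tangent bundle of the sphere -/

/-- The equatorial two-sphere, zero set of the first coordinate. -/
def equator : Set S3 := {p | coord 0 p = 0}

theorem mem_equator {p : S3} : p ∈ equator ↔ coord 0 p = 0 := Iff.rfl

theorem coord_mul_cancel {f h : Smooth S3} (e : coord 0 * f = coord 0 * h) : f = h := by
  rw [← sub_eq_zero]
  apply eq_zero_of_coord_mul_eq_zero
  rw [mul_sub, e, sub_self]

/-- Since functions vanishing on the equator are multiples of the first coordinate, the differential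
of that coordinate alone cuts out the tangent spaces of the equator. -/
theorem mem_tangentTo_equator {p : S3} (hp : p ∈ equator) (v : TangentSpace (𝓡 3) p) :
    v ∈ tangentTo equator p ↔ mvfderiv (𝓡 3) (coord 0) p v = 0 := by
  refine ⟨fun h => h (coord 0) fun x hx => hx, fun h f hf => ?_⟩
  obtain ⟨k, rfl⟩ := exists_eq_coord_mul f hf
  have h1 := congrArg (fun L => L v)
    (mvfderiv_mul ((coord 0).contMDiff.mdifferentiableAt (x := p) (by simp))
      (k.contMDiff.mdifferentiableAt (by simp)))
  refine h1.trans ?_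
  simp [h, mem_equator.1 hp]

theorem sum_coord_sq' : coord 0 ^ 2 + coord 1 ^ 2 + coord 2 ^ 2 + coord 3 ^ 2 = 1 := by
  ext p
  exact sum_coord_sq p

theorem sum_coord_mul_along (V : VField S3) :
    coord 0 * along V (coord 0) + coord 1 * along V (coord 1) + coord 2 * along V (coord 2) +
      coord 3 * along V (coord 3) = 0 := by
  ext p
  have h := sum_coord_mul_mvfderiv p (V p)
  rw [Fin.sum_univ_four] at h
  exact h

theorem along_grad (i j : Fin 4) :
    along (grad i) (coord j) = (if j = i then 1 else 0) - coord i * coord j := by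
  ext p
  refine (mvfderiv_coord_grad i j p).trans ?_
  split_ifs <;> rfl

/-- The logarithmic differential of the first coordinate, as a form on b-vector fields. -/
def dlog : bFields equator →ₗ[Smooth S3] Smooth S3 :=
  have h : ∀ V : bFields equator, ∃ f, along (V : VField S3) (coord 0) = coord 0 * f :=
    fun V => exists_eq_coord_mul _ fun p hp => V.2 p hp (coord 0) fun _ hx => hx
  { toFun := fun V => (h V).choose
    map_add' := fun V W => coord_mul_cancel <| by
      rw [mul_add, ← (h (V + W)).choose_spec, ← (h V).choose_spec, ← (h W).choose_spec]
      exact along_add_field _ _ _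
    map_smul' := fun f V => coord_mul_cancel <| by
      rw [RingHom.id_apply, smul_eq_mul, mul_left_comm, ← (h (f • V)).choose_spec,
        ← (h V).choose_spec]
      exact along_smul_field _ _ _ }

theorem along_coord_zero (V : bFields equator) :
    along (V : VField S3) (coord 0) = coord 0 * dlog V :=
  (exists_eq_coord_mul (along (V : VField S3) (coord 0)) fun p hp =>
    V.2 p hp (coord 0) fun _ hx => hx).choose_spec

/-- The logarithmic differential is closed. -/
theorem dlog_bracket (V W : bFields equator) :
    dlog (bBracket V W) = along (V : VField S3) (dlog W) - along (W : VField S3) (dlog V) := by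
  apply coord_mul_cancel
  rw [← along_coord_zero]
  change along (bracket (V : VField S3) W) (coord 0) = _
  rw [along_bracket, along_coord_zero, along_coord_zero, along_mul, along_mul, along_coord_zero,
    along_coord_zero]
  ring

/-- The differential of a coordinate, as a form on b-vector fields. -/
def dcoord (j : Fin 4) : bFields equator →ₗ[Smooth S3] Smooth S3 where
  toFun V := along (V : VField S3) (coord j)
  map_add' _ _ := along_add_field _ _ _
  map_smul' _ _ := along_smul_field _ _ _

theorem dcoord_bracket (j : Fin 4) (V W : bFields equator) :
    dcoord j (bBracket V W) =
      along (V : VField S3) (dcoord j W) - along (W : VField S3) (dcoord j V) :=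
  along_bracket _ _ _

/-- The global frame of the b-tangent bundle: the gradients of the last three coordinates. -/
def frame (i : Fin 3) : bFields equator :=
  ⟨grad i.succ, fun p hp => by
    rw [mem_tangentTo_equator hp, mvfderiv_coord_grad, mem_equator.1 hp,
      if_neg (Fin.succ_ne_zero i).symm]
    simp⟩

/-- The coframe dual to `frame`. -/
def coframe (i : Fin 3) : bFields equator →ₗ[Smooth S3] Smooth S3 :=
  dcoord i.succ - coord i.succ • dlog

theorem coframe_apply (i : Fin 3) (V : bFields equator) :
    coframe i V = dcoord i.succ V - coord i.succ * dlog V := rfl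

theorem dlog_frame (i : Fin 3) : dlog (frame i) = -coord i.succ := by
  apply coord_mul_cancel
  rw [← along_coord_zero]
  refine (along_grad _ _).trans ?_
  rw [if_neg (Fin.succ_ne_zero i).symm]
  ring

theorem coframe_frame (i j : Fin 3) : coframe i (frame j) = if i = j then 1 else 0 := by
  rw [coframe_apply, dlog_frame]
  change along (grad j.succ) (coord i.succ) - _ = _
  rw [along_grad]
  simp only [Fin.succ_inj]
  ring

/-- The coframe determines `dx/x`, because `∑ cᵢ dcᵢ = 0` on the sphere. -/
theorem sum_coord_mul_coframe (V : bFields equator) :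
    coord 1 * coframe 0 V + coord 2 * coframe 1 V + coord 3 * coframe 2 V = -dlog V := by
  have h := sum_coord_mul_along (V : VField S3)
  rw [along_coord_zero] at h
  change _ + coord 1 * dcoord 1 V + coord 2 * dcoord 2 V + coord 3 * dcoord 3 V = _ at h
  simp only [coframe_apply]
  change coord 1 * (dcoord 1 V - coord 1 * dlog V) + coord 2 * (dcoord 2 V - coord 2 * dlog V) +
    coord 3 * (dcoord 3 V - coord 3 * dlog V) = _
  linear_combination h - dlog V * sum_coord_sq'

theorem eq_sum_coframe_smul_frame (V : bFields equator) :
    V = coframe 0 V • frame 0 + coframe 1 V • frame 1 + coframe 2 V • frame 2 := by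
  apply Subtype.ext
  have h0 := sum_coord_mul_coframe V
  refine field_ext fun j => ?_
  change _ = along (coframe 0 V • grad 1 + coframe 1 V • grad 2 + coframe 2 V • grad 3) (coord j)
  simp only [along_add_field, along_smul_field, along_grad]
  fin_cases j
  · change along (V : VField S3) (coord 0) = _
    rw [along_coord_zero]
    simp
    linear_combination coord 0 * h0
  · change dcoord 1 V = _
    have h1 : coframe 0 V = dcoord 1 V - coord 1 * dlog V := rfl
    simp
    linear_combination coord 1 * h0 - h1
  · change dcoord 2 V = _
    have h1 : coframe 1 V = dcoord 2 V - coord 2 * dlog V := rfl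
    simp
    linear_combination coord 2 * h0 - h1
  · change dcoord 3 V = _
    have h1 : coframe 2 V = dcoord 3 V - coord 3 * dlog V := rfl
    simp
    linear_combination coord 3 * h0 - h1

/-- A b-vector field vanishes at a point of the b-tangent bundle exactly when its components in the
frame do. -/
theorem vanishesAt_iff (V : bFields equator) (p : S3) :
    VanishesAt V p ↔ ∀ i, coframe i V p = 0 := by
  constructor
  · intro h i
    refine Submodule.smul_induction_on (p := fun V : bFields equator => coframe i V p = 0) h
      (fun f hf W _ => ?_) fun V W hV hW => ?_
    · rw [map_smul]
      change f p * coframe i W p = 0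
      have hf : f p = 0 := hf
      rw [hf, zero_mul]
    · rw [map_add]
      change coframe i V p + coframe i W p = 0
      rw [hV, hW, add_zero]
  · intro h
    have h1 : ∀ i, coframe i V • frame i ∈ (RingHom.ker (ContMDiffMap.evalRingHom p :
        Smooth S3 →+* ℝ) • ⊤ : Submodule (Smooth S3) (bFields equator)) :=
      fun i => Submodule.smul_mem_smul (h i) Submodule.mem_top
    rw [VanishesAt, eq_sum_coframe_smul_frame V]
    exact add_mem (add_mem (h1 0) (h1 1)) (h1 2)

/-! ### The Beltrami field -/

/-- The components of the Beltrami field in the global frame. -/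
def beltramiComp : Fin 3 → Smooth S3 :=
  ![coord 0 ^ 2 + coord 1 ^ 2, coord 1 * coord 2 - coord 3, coord 2 + coord 1 * coord 3]

/-- The Beltrami field. As a field of vectors of `ℝ⁴`, it is `(-x y, x ^ 2, -v, u)` in the
coordinates `(x, y, u, v)`. -/
def beltrami : bFields equator := ∑ i, beltramiComp i • frame i

/-- The contact form `2 dy - 2 y dx / x + u dv - v du`. -/
def contact : bFields equator →ₗ[Smooth S3] Smooth S3 :=
  (2 : Smooth S3) • coframe 0 - coord 3 • coframe 1 + coord 2 • coframe 2

/-- The b-volume form for which the global frame is unimodular. -/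
def volume : BForm equator 3 :=
  (Matrix.detRowAlternating (R := Smooth S3) (n := Fin 3)).compLinearMap (LinearMap.pi coframe)

theorem two_apply (p : S3) : (2 : Smooth S3) p = 2 :=
  map_ofNat (ContMDiffMap.evalRingHom p : Smooth S3 →+* ℝ) 2

theorem coframe_beltrami (i : Fin 3) : coframe i beltrami = beltramiComp i := by
  rw [beltrami, map_sum]
  simp [coframe_frame]

theorem isBVolume_volume : IsBVolume volume := by
  intro p
  refine ⟨frame, ?_⟩
  have h : volume frame = 1 := by
    have h1 : (Matrix.of fun i j => coframe j (frame i) :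
        Matrix (Fin 3) (Fin 3) (Smooth S3)) = 1 := by
      refine Matrix.ext fun i j => ?_
      rw [Matrix.of_apply, coframe_frame, Matrix.one_apply]
      simp only [eq_comm]
    exact (congrArg Matrix.det h1).trans Matrix.det_one
  rw [h]
  exact one_ne_zero

theorem contact_apply (V : bFields equator) :
    contact V = 2 * dcoord 1 V - 2 * coord 1 * dlog V + coord 2 * dcoord 3 V
      - coord 3 * dcoord 2 V := by
  change 2 * (dcoord 1 V - coord 1 * dlog V) - coord 3 * (dcoord 2 V - coord 2 * dlog V) +
    coord 2 * (dcoord 3 V - coord 3 * dlog V) = _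
  ring

/-- The contraction `ι_X μ` is `dx/x ∧ dy + du ∧ dv`. After rewriting both sides in the coframe, this
follows from `x² + y² + u² + v² = 1` and `sum_coord_mul_coframe`. -/
theorem curryLeft_volume_beltrami (V W : bFields equator) :
    volume.curryLeft beltrami ![V, W] =
      dlog V * dcoord 1 W - dlog W * dcoord 1 V + dcoord 2 V * dcoord 3 W
        - dcoord 2 W * dcoord 3 V := by
  have h : volume.curryLeft beltrami ![V, W] =
      Matrix.det (Matrix.of ![beltramiComp, fun j => coframe j V, fun j => coframe j W]) := by
    change Matrix.det (Matrix.of fun i j => coframe j ((Matrix.vecCons beltrami ![V, W]) i)) = _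
    congr 2
    ext1 i
    fin_cases i
    · exact funext coframe_beltrami
    · rfl
    · rfl
  rw [h, Matrix.det_fin_three]
  have hV := sum_coord_mul_coframe V
  have hW := sum_coord_mul_coframe W
  have h1 : ∀ U, dcoord 1 U = coframe 0 U + coord 1 * dlog U := fun U => by
    rw [coframe_apply]; exact (sub_add_cancel _ _).symm
  have h2 : ∀ U, dcoord 2 U = coframe 1 U + coord 2 * dlog U := fun U => by
    rw [coframe_apply]; exact (sub_add_cancel _ _).symm
  have h3 : ∀ U, dcoord 3 U = coframe 2 U + coord 3 * dlog U := fun U => by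
    rw [coframe_apply]; exact (sub_add_cancel _ _).symm
  simp only [h1, h2, h3]
  simp only [beltramiComp, Matrix.of_apply, Matrix.cons_val]
  linear_combination (-coframe 0 W - coord 2 * coframe 2 W + coord 3 * coframe 1 W) * hV +
    (coframe 0 V + coord 2 * coframe 2 V - coord 3 * coframe 1 V) * hW +
    (coframe 1 V * coframe 2 W - coframe 2 V * coframe 1 W) * sum_coord_sq'

theorem dOne_contact (V W : bFields equator) :
    dOne contact V W = 2 * volume.curryLeft beltrami ![V, W] := by
  rw [curryLeft_volume_beltrami, dOne, contact_apply, contact_apply, contact_apply]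
  simp only [dcoord_bracket, dlog_bracket, along_add, along_sub, along_mul, along_two]
  have hd : ∀ (j : Fin 4) (U : bFields equator), along (U : VField S3) (coord j) = dcoord j U :=
    fun _ _ => rfl
  simp only [hd]
  ring

theorem dTwo_curryLeft_volume (U V W : bFields equator) :
    dTwo (volume.curryLeft beltrami) U V W = 0 := by
  simp only [dTwo, curryLeft_volume_beltrami, dcoord_bracket, dlog_bracket, along_add, along_sub,
    along_mul]
  ring

/-- The squared length of the Beltrami field for the metric making the global frame orthonormal. -/
def normSq : Smooth S3 := ∑ i, beltramiComp i ^ 2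

/-- The pairing with the Beltrami field for the metric making the global frame orthonormal. -/
def flat : bFields equator →ₗ[Smooth S3] Smooth S3 := ∑ i, beltramiComp i • coframe i

theorem flat_beltrami : flat beltrami = normSq := by
  simp only [flat, normSq, LinearMap.sum_apply, LinearMap.smul_apply, coframe_beltrami, smul_eq_mul,
    sq]

theorem contact_beltrami : contact beltrami = 1 + coord 0 ^ 2 + coord 1 ^ 2 := by
  change 2 * coframe 0 beltrami - coord 3 * coframe 1 beltrami + coord 2 * coframe 2 beltrami = _
  simp only [coframe_beltrami, beltramiComp, Matrix.cons_val]
  linear_combination sum_coord_sq'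

theorem contact_beltrami_pos (p : S3) : 0 < contact beltrami p := by
  rw [contact_beltrami]
  change 0 < 1 + coord 0 p ^ 2 + coord 1 p ^ 2
  positivity

/-- The inverse of the positive function `contact beltrami`. -/
def contactInv : Smooth S3 :=
  ⟨fun p => (contact beltrami p)⁻¹, fun p =>
    ((contact beltrami).contMDiff p).inv₀ (contact_beltrami_pos p).ne'⟩

theorem contact_mul_contactInv : contact beltrami * contactInv = 1 := by
  ext p
  exact mul_inv_cancel₀ (contact_beltrami_pos p).ne'

/-- The b-metric `α ⊗ α / α(X) + |X|² ⟨·, ·⟩ - ⟨X, ·⟩ ⟨X, ·⟩`, where `X` is the Beltrami field, `α`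
the contact form, and `⟨·, ·⟩` makes the global frame orthonormal. The last two terms vanish on `X`,
so that `X` is dual to `α`. -/
def metricForm : bFields equator →ₗ[Smooth S3] bFields equator →ₗ[Smooth S3] Smooth S3 :=
  contact.smulRight (contactInv • contact) + ∑ i, (coframe i).smulRight (normSq • coframe i) -
    flat.smulRight flat

theorem metricForm_apply (V W : bFields equator) :
    metricForm V W = contact V * (contactInv * contact W) +
      ∑ i, coframe i V * (normSq * coframe i W) - flat V * flat W := by
  simp only [metricForm, LinearMap.sub_apply, LinearMap.add_apply, LinearMap.sum_apply,
    LinearMap.smulRight_apply, LinearMap.smul_apply, smul_eq_mul]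

theorem metricForm_beltrami : metricForm beltrami = contact := by
  refine LinearMap.ext fun W => ?_
  rw [metricForm_apply, flat_beltrami]
  have h : ∑ i, coframe i beltrami * (normSq * coframe i W) = normSq * flat W := by
    simp only [flat, LinearMap.sum_apply, LinearMap.smul_apply, coframe_beltrami, smul_eq_mul,
      Finset.mul_sum]
    exact Finset.sum_congr rfl fun i _ => by ring
  rw [h]
  linear_combination contact W * contact_mul_contactInv

/-- The quadratic form `⟨α, w⟩² / ⟨α, X⟩ + |X|² |w|² - ⟨X, w⟩²` on `ℝ³` is positive definite if
`⟨α, X⟩ > 0`: by Cauchy–Schwarz it can only vanish at a multiple of `X` orthogonal to `α`. -/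
theorem dual_form_pos {p q r k l m a b c : ℝ} (hs : 0 < p * k + q * l + r * m)
    (h0 : ¬(a = 0 ∧ b = 0 ∧ c = 0)) :
    0 < (p * a + q * b + r * c) * ((p * k + q * l + r * m)⁻¹ * (p * a + q * b + r * c)) +
      (a * ((k ^ 2 + l ^ 2 + m ^ 2) * a) + b * ((k ^ 2 + l ^ 2 + m ^ 2) * b) +
        c * ((k ^ 2 + l ^ 2 + m ^ 2) * c)) -
      (k * a + l * b + m * c) * (k * a + l * b + m * c) := by
  have hs' := inv_pos.2 hs
  generalize (p * k + q * l + r * m)⁻¹ = t at *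
  generalize hA : p * a + q * b + r * c = A
  -- Lagrange's identity
  have hL : A * (t * A) + (a * ((k ^ 2 + l ^ 2 + m ^ 2) * a) + b * ((k ^ 2 + l ^ 2 + m ^ 2) * b) +
      c * ((k ^ 2 + l ^ 2 + m ^ 2) * c)) - (k * a + l * b + m * c) * (k * a + l * b + m * c) =
      t * A ^ 2 + ((k * b - l * a) ^ 2 + (k * c - m * a) ^ 2 + (l * c - m * b) ^ 2) := by ring
  rw [hL]
  by_contra! hle
  have h1 : 0 ≤ t * A ^ 2 := by positivity
  have s1 := sq_nonneg (k * b - l * a)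
  have s2 := sq_nonneg (k * c - m * a)
  have s3 := sq_nonneg (l * c - m * b)
  have hA0 : A = 0 := by
    have : t * A ^ 2 = 0 := by linarith
    simpa [hs'.ne'] using this
  have e1 : k * b - l * a = 0 := (pow_eq_zero_iff two_ne_zero).1 (by linarith)
  have e2 : k * c - m * a = 0 := (pow_eq_zero_iff two_ne_zero).1 (by linarith)
  have e3 : l * c - m * b = 0 := (pow_eq_zero_iff two_ne_zero).1 (by linarith)
  rw [hA0] at hA
  refine h0 ⟨?_, ?_, ?_⟩ <;> refine (mul_eq_zero.1 ?_).resolve_left hs.ne'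
  · linear_combination -q * e1 - r * e2 + k * hA
  · linear_combination p * e1 - r * e3 + l * hA
  · linear_combination p * e2 + q * e3 + m * hA

theorem metricForm_pos (V : bFields equator) (p : S3) (hV : ¬ VanishesAt V p) :
    0 < metricForm V V p := by
  have hs := contact_beltrami_pos p
  have hX : contact beltrami p = 2 * beltramiComp 0 p + -coord 3 p * beltramiComp 1 p +
      coord 2 p * beltramiComp 2 p := by
    rw [← two_apply p, ← coframe_beltrami, ← coframe_beltrami, ← coframe_beltrami, neg_mul,
      ← sub_eq_add_neg]
    rfl
  have hM : metricForm V V p = contact V p * ((contact beltrami p)⁻¹ * contact V p) +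
      (coframe 0 V p * (normSq p * coframe 0 V p) + coframe 1 V p * (normSq p * coframe 1 V p) +
        coframe 2 V p * (normSq p * coframe 2 V p)) - flat V p * flat V p := by
    rw [metricForm_apply, Fin.sum_univ_three]
    rfl
  have hA : contact V p = 2 * coframe 0 V p + -coord 3 p * coframe 1 V p +
      coord 2 p * coframe 2 V p := by
    rw [← two_apply p, neg_mul, ← sub_eq_add_neg]
    rfl
  have hN : normSq p = beltramiComp 0 p ^ 2 + beltramiComp 1 p ^ 2 + beltramiComp 2 p ^ 2 := by
    rw [normSq, Fin.sum_univ_three]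
    rfl
  have hF : flat V p = beltramiComp 0 p * coframe 0 V p + beltramiComp 1 p * coframe 1 V p +
      beltramiComp 2 p * coframe 2 V p := by
    rw [flat, Fin.sum_univ_three]
    rfl
  rw [hM, hN, hF, hA, hX]
  refine dual_form_pos (hX ▸ hs) fun h => hV ((vanishesAt_iff V p).2 fun i => ?_)
  fin_cases i
  exacts [h.1, h.2.1, h.2.2]

/-- The b-metric for which the Beltrami field is dual to the contact form. -/
def metric : BMetric equator where
  form := metricForm
  symm V W := by
    simp only [metricForm_apply]
    rw [mul_comm (flat V)]
    congr 2
    · ring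
    · exact Finset.sum_congr rfl fun i _ => by ring
  pos := metricForm_pos

theorem isRotationalBeltrami : IsRotationalBeltrami metric volume beltrami := by
  refine ⟨⟨2, fun p => by simp [two_apply], fun V W => ?_⟩, dTwo_curryLeft_volume⟩
  rw [← dOne_contact]
  exact congrArg (fun α => dOne α V W) metricForm_beltrami

theorem not_vanishesAt_beltrami (p : S3) : ¬ VanishesAt beltrami p := by
  intro h
  rw [vanishesAt_iff] at h
  have h1 := contact_beltrami_pos p
  have h2 : contact beltrami p = (2 : Smooth S3) p * coframe 0 beltrami p -
    coord 3 p * coframe 1 beltrami p + coord 2 p * coframe 2 beltrami p := rfl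
  rw [h2, h, h, h] at h1
  simp at h1

/-- Off the equator, the second coordinate increases along the flow of the Beltrami field. -/
theorem along_beltrami_coord_one : along (beltrami : VField S3) (coord 1) = coord 0 ^ 2 := by
  change dcoord 1 beltrami = _
  have h : coframe 0 beltrami = dcoord 1 beltrami - coord 1 * dlog beltrami := rfl
  have h2 := sum_coord_mul_coframe beltrami
  simp only [coframe_beltrami, beltramiComp, Matrix.cons_val] at h h2
  linear_combination -h + coord 1 * h2 - coord 1 ^ 2 * sum_coord_sq'

theorem not_isPeriodicOrbit (γ : ℝ → S3) (hγ : IsPeriodicOrbit (beltrami : VField S3) γ) :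
    ∃ t, γ t ∈ equator := by
  by_contra! hZ
  obtain ⟨hint, ⟨T, hT, hper⟩, -⟩ := hγ
  have hd : ∀ t, HasDerivAt (fun t => coord 1 (γ t)) (coord 0 (γ t) ^ 2) t := by
    intro t
    have h1 : HasMFDerivAt (𝓡 3) 𝓘(ℝ, ℝ) (coord 1) (γ t) (mfderiv (𝓡 3) 𝓘(ℝ, ℝ) (coord 1) (γ t)) :=
      ((coord 1).contMDiff.mdifferentiableAt (by simp)).hasMFDerivAt
    have h2 : HasFDerivAt (fun t => coord 1 (γ t)) (_ : ℝ →L[ℝ] ℝ) t :=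
      (h1.comp t (hint t)).hasFDerivAt
    refine h2.hasDerivAt.congr_deriv ?_
    have h3 : mvfderiv (𝓡 3) (coord 1) (γ t) ((beltrami : VField S3) (γ t)) = coord 0 (γ t) ^ 2 :=
      congrArg (fun f : Smooth S3 => f (γ t)) along_beltrami_coord_one
    rw [← h3]
    change mfderiv (𝓡 3) 𝓘(ℝ, ℝ) (coord 1) (γ t) ((1 : ℝ) • (beltrami : VField S3) (γ t)) = _
    rw [one_smul]
    rfl
  have hmono : StrictMono fun t => coord 1 (γ t) := strictMono_of_deriv_pos fun t => by
    rw [(hd t).deriv]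
    exact sq_pos_of_ne_zero (hZ t)
  have h := hmono hT
  have h0 := hper 0
  rw [zero_add] at h0
  simp [h0] at h

/-! ### Orientations of the sphere and its equator -/

/-- A family on which an alternating form of top degree is positive is a basis, and that form
represents its orientation. -/
theorem exists_basis_orientation_eq {V : Type*} [AddCommGroup V] [Module ℝ V]
    [FiniteDimensional ℝ V] {n : ℕ} [NeZero n] (hn : Module.finrank ℝ V = n)
    {σ : V [⋀^Fin n]→ₗ[ℝ] ℝ} (hσ : σ ≠ 0) {v : Fin n → V} (hv : 0 < σ v) :
    ∃ b : Module.Basis (Fin n) ℝ V, (∀ i, b i = v i) ∧ b.orientation = rayOfNeZero ℝ σ hσ := by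
  have hli : LinearIndependent ℝ v := by
    by_contra h
    exact hv.ne' (σ.map_linearDependent v h)
  let b := basisOfLinearIndependentOfCardEqFinrank hli (by simp [hn])
  have hb : ⇑b = v := coe_basisOfLinearIndependentOfCardEqFinrank hli _
  refine ⟨b, fun i => congrFun hb i, ?_⟩
  rw [Module.Basis.orientation, ray_eq_iff]
  have h : σ = σ v • b.det := by
    rw [← hb]
    exact σ.eq_smul_basis_det b
  rw [h]
  exact SameRay.sameRay_pos_smul_right _ hv

instance (p : S3) : FiniteDimensional ℝ (TangentSpace (𝓡 3) p) :=
  inferInstanceAs (FiniteDimensional ℝ (EuclideanSpace ℝ (Fin 3)))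

theorem finrank_tangentSpace (p : S3) : Module.finrank ℝ (TangentSpace (𝓡 3) p) = 3 :=
  finrank_euclideanSpace_fin (𝕜 := ℝ) (n := 3)

/-- The vector field with given components `w` in `ℝ⁴`, projected to the tangent spaces. -/
def tangential (w : Fin 4 → Smooth S3) : VField S3 :=
  w 0 • grad 0 + w 1 • grad 1 + w 2 • grad 2 + w 3 • grad 3

theorem along_tangential (w : Fin 4 → Smooth S3)
    (hw : w 0 * coord 0 + w 1 * coord 1 + w 2 * coord 2 + w 3 * coord 3 = 0) (j : Fin 4) :
    along (tangential w) (coord j) = w j := by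
  simp only [tangential, along_add_field, along_smul_field, along_grad]
  fin_cases j <;> simp
  · linear_combination -coord 0 * hw
  · linear_combination -coord 1 * hw
  · linear_combination -coord 2 * hw
  · linear_combination -coord 3 * hw

/-- The global frame `i p, j p, k p` of the tangent bundle given by quaternion multiplication. -/
def quaternionFrame : Fin 3 → VField S3 :=
  ![tangential ![-coord 1, coord 0, -coord 3, coord 2],
    tangential ![-coord 2, coord 3, coord 0, -coord 1],
    tangential ![-coord 3, -coord 2, coord 1, coord 0]]

theorem linearIndependent_quaternionFrame (p : S3) :
    LinearIndependent ℝ fun i => quaternionFrame i p := by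
  rw [Fintype.linearIndependent_iff]
  intro a ha
  -- Apply the relation to the four coordinates. The frame is orthonormal in `ℝ⁴`, so pairing the
  -- result with the `i`-th field isolates the `i`-th coefficient.
  have h0 := along_tangential ![-coord 1, coord 0, -coord 3, coord 2] (by simp; ring)
  have h1 := along_tangential ![-coord 2, coord 3, coord 0, -coord 1] (by simp; ring)
  have h2 := along_tangential ![-coord 3, -coord 2, coord 1, coord 0] (by simp; ring)
  have h : ∀ j, a 0 * along (quaternionFrame 0) (coord j) p +
      a 1 * along (quaternionFrame 1) (coord j) p +
      a 2 * along (quaternionFrame 2) (coord j) p = 0 := by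
    intro j
    have := congrArg (mvfderiv (𝓡 3) (coord j) p) ha
    rw [Fin.sum_univ_three, map_add, map_add, map_smul, map_smul, map_smul, map_zero] at this
    exact this
  have e : ∀ j, a 0 * (![-coord 1, coord 0, -coord 3, coord 2] : Fin 4 → Smooth S3) j p +
      a 1 * (![-coord 2, coord 3, coord 0, -coord 1] : Fin 4 → Smooth S3) j p +
      a 2 * (![-coord 3, -coord 2, coord 1, coord 0] : Fin 4 → Smooth S3) j p = 0 := by
    intro j
    rw [← h0 j, ← h1 j, ← h2 j]
    exact h j
  have e0 : a 0 * (-coord 1 p) + a 1 * (-coord 2 p) + a 2 * (-coord 3 p) = 0 := e 0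
  have e1 : a 0 * coord 0 p + a 1 * coord 3 p + a 2 * (-coord 2 p) = 0 := e 1
  have e2 : a 0 * (-coord 3 p) + a 1 * coord 0 p + a 2 * coord 1 p = 0 := e 2
  have e3 : a 0 * coord 2 p + a 1 * (-coord 1 p) + a 2 * coord 0 p = 0 := e 3
  have hs := sum_coord_sq p
  intro i
  fin_cases i
  · change a 0 = 0
    linear_combination -coord 1 p * e0 + coord 0 p * e1 - coord 3 p * e2 + coord 2 p * e3 - a 0 * hs
  · change a 1 = 0
    linear_combination -coord 2 p * e0 + coord 3 p * e1 + coord 0 p * e2 - coord 1 p * e3 - a 1 * hs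
  · change a 2 = 0
    linear_combination -coord 3 p * e0 - coord 2 p * e1 + coord 1 p * e2 + coord 0 p * e3 - a 2 * hs

/-- The basis of the tangent space given by the quaternionic frame. -/
def quaternionBasis (p : S3) : Module.Basis (Fin 3) ℝ (TangentSpace (𝓡 3) p) :=
  basisOfLinearIndependentOfCardEqFinrank (linearIndependent_quaternionFrame p)
    (by rw [finrank_tangentSpace, Fintype.card_fin])

theorem isHypersurface_equator : IsHypersurface equator := by
  refine ⟨isClosed_eq (coord 0).contMDiff.continuous continuous_const, fun p _ =>
    ⟨Set.univ, isOpen_univ, Set.mem_univ p, coord 0, (coord 0).contMDiff.contMDiffOn,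
      fun x _ => Iff.rfl, fun x _ hx h => ?_⟩⟩
  have h1 := mvfderiv_coord_grad 0 0 x
  rw [h, mem_equator.1 hx] at h1
  simp at h1

theorem finrank_tangentTo_equator (z : equator) :
    Module.finrank ℝ (tangentTo equator (z : S3)) = 2 := by
  have h : tangentTo equator (z : S3) =
      LinearMap.ker (mvfderiv (𝓡 3) (coord 0) (z : S3)).toLinearMap := by
    ext v
    exact mem_tangentTo_equator z.2 v
  have h0 : (mvfderiv (𝓡 3) (coord 0) (z : S3)).toLinearMap ≠ 0 := by
    intro h
    have h1 := mvfderiv_coord_grad 0 0 (z : S3)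
    have h2 : mvfderiv (𝓡 3) (coord 0) (z : S3) (grad 0 z) = 0 := congrArg (fun L => L (grad 0 z)) h
    rw [h2, mem_equator.1 z.2] at h1
    simp at h1
  have h2 := Module.Dual.finrank_ker_add_one_of_ne_zero h0
  rw [finrank_tangentSpace] at h2
  rw [h]
  omega

/-- The unit normal of the equator in `ℝ³`, which is the position vector. -/
def normal (z : equator) : Fin 3 → ℝ := fun i => coord i.succ (z : S3)

/-- The area form `det (n, ·, ·)` of the equator as a sphere in `ℝ³` with unit normal `n`. -/
def area (z : equator) : (tangentTo equator (z : S3)) [⋀^Fin 2]→ₗ[ℝ] ℝ :=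
  ((Matrix.detRowAlternating (R := ℝ) (n := Fin 3)).curryLeft (normal z)).compLinearMap
    ((LinearMap.pi fun i : Fin 3 => (mvfderiv (𝓡 3) (coord i.succ) (z : S3)).toLinearMap).comp
      (tangentTo equator (z : S3)).subtype)

/-- The `j`-th field of the frame is `e_j` up to a multiple of the normal, which `area` ignores. -/
theorem area_frame (z : equator) (j l : Fin 3) :
    area z ![⟨_, (frame j).2 z z.2⟩, ⟨_, (frame l).2 z z.2⟩] =
      Matrix.det (Matrix.of ![normal z, Pi.single j 1, Pi.single l 1]) := by
  have hE : ∀ j i : Fin 3, mvfderiv (𝓡 3) (coord i.succ) (z : S3) (grad j.succ z) =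
      (Pi.single j 1 : Fin 3 → ℝ) i - normal z j * normal z i := by
    intro j i
    rw [mvfderiv_coord_grad, Pi.single_apply]
    simp only [Fin.succ_inj]
    rfl
  have h : area z ![⟨_, (frame j).2 z z.2⟩, ⟨_, (frame l).2 z z.2⟩] =
      Matrix.det (Matrix.of ![normal z,
        fun i => (Pi.single j 1 : Fin 3 → ℝ) i - normal z j * normal z i,
        fun i => (Pi.single l 1 : Fin 3 → ℝ) i - normal z l * normal z i]) := by
    refine congrArg (fun A : Fin 3 → Fin 3 → ℝ => Matrix.det (Matrix.of A)) ?_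
    ext1 k
    fin_cases k
    · rfl
    · exact funext (hE j)
    · exact funext (hE l)
  rw [h, Matrix.det_fin_three, Matrix.det_fin_three]
  simp only [Matrix.of_apply, Matrix.cons_val]
  ring

/-- The triple product `det (n, e_j, e_l)` is, up to sign, the remaining component of `n`, so it is
positive for some ordered pair `(j, l)`. -/
theorem exists_area_frame_pos (z : equator) :
    ∃ j l, 0 < Matrix.det (Matrix.of ![normal z, Pi.single j 1, Pi.single l 1]) := by
  by_contra! h
  have h01 := h 0 1
  have h10 := h 1 0
  have h02 := h 0 2
  have h20 := h 2 0
  have h12 := h 1 2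
  have h21 := h 2 1
  simp [Matrix.det_fin_three] at h01 h10 h02 h20 h12 h21
  have hs := sum_coord_sq (z : S3)
  have e0 : coord 1 (z : S3) = normal z 0 := rfl
  have e1 : coord 2 (z : S3) = normal z 1 := rfl
  have e2 : coord 3 (z : S3) = normal z 2 := rfl
  rw [mem_equator.1 z.2, e0, e1, e2, le_antisymm h12 h21, le_antisymm h01 h10,
    le_antisymm h20 h02] at hs
  simp at hs

theorem area_ne_zero (z : equator) : area z ≠ 0 := by
  intro h
  obtain ⟨j, l, hjl⟩ := exists_area_frame_pos z
  rw [← area_frame, h] at hjl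
  exact lt_irrefl _ hjl

theorem continuous_normal : Continuous normal :=
  continuous_pi fun i => (coord i.succ).contMDiff.continuous.comp continuous_subtype_val

/-- The three-sphere with its equator, both with their standard orientations. -/
def bManifold : BManifold S3 where
  Z := equator
  isHypersurface := isHypersurface_equator
  orient p := (quaternionBasis p).orientation
  orient_continuous p := ⟨Set.univ, Filter.univ_mem, quaternionFrame, fun x _ =>
    ⟨quaternionBasis x, fun i => congrFun
      (coe_basisOfLinearIndependentOfCardEqFinrank (linearIndependent_quaternionFrame x) _) i, rfl⟩⟩
  orientZ z := rayOfNeZero ℝ (area z) (area_ne_zero z)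
  orientZ_continuous z := by
    obtain ⟨j, l, hjl⟩ := exists_area_frame_pos z
    have hc : Continuous fun z : equator =>
        Matrix.det (Matrix.of ![normal z, Pi.single j 1, Pi.single l 1]) := by
      refine Continuous.matrix_det (continuous_matrix fun i k => ?_)
      fin_cases i
      · exact (continuous_apply k).comp continuous_normal
      · exact continuous_const
      · exact continuous_const
    refine ⟨_, (isOpen_lt continuous_const hc).mem_nhds hjl, ![grad j.succ, grad l.succ],
      fun x hx => ?_⟩
    have hx' := lt_of_lt_of_eq hx (area_frame x j l).symm
    obtain ⟨b, hb, hbo⟩ := exists_basis_orientation_eq (finrank_tangentTo_equator x)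
      (area_ne_zero x) hx'
    refine ⟨b, fun i => ?_, hbo⟩
    rw [hb]
    fin_cases i <;> rfl

/-! ### Connectedness and the counterexample -/

instance : ConnectedSpace S3 :=
  isConnected_iff_connectedSpace.1 <| isConnected_sphere
    (by rw [← Module.finrank_eq_rank, finrank_euclideanSpace_fin]; norm_num) 0 zero_le_one

theorem equator_nonempty : equator.Nonempty :=
  ⟨⟨EuclideanSpace.single 1 1, by simp⟩, by simp [mem_equator, coord_apply]⟩

end

end S3
end BGeometry

theorem mainTheorem6 :
    ∃ (M : Type) (_ : TopologicalSpace M) (_ : ChartedSpace (EuclideanSpace ℝ (Fin 3)) M)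
      (_ : IsManifold (𝓡 3) ∞ M) (_ : T2Space M) (_ : CompactSpace M) (_ : ConnectedSpace M)
      (B : BGeometry.BManifold M) (g : BGeometry.BMetric B.Z) (μ : BGeometry.BForm B.Z 3)
      (X : BGeometry.bFields B.Z),
      B.Z.Nonempty ∧
      BGeometry.IsBVolume μ ∧
      BGeometry.IsRotationalBeltrami g μ X ∧
      (∀ p : M, ¬ BGeometry.VanishesAt X p) ∧
      ¬ ∃ γ : ℝ → M, BGeometry.IsPeriodicOrbit (X : BGeometry.VField M) γ ∧
        ∀ t : ℝ, γ t ∉ B.Z := by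
  refine ⟨BGeometry.S3, inferInstance, inferInstance, inferInstance, inferInstance, inferInstance,
    inferInstance, BGeometry.S3.bManifold, BGeometry.S3.metric, BGeometry.S3.volume,
    BGeometry.S3.beltrami, BGeometry.S3.equator_nonempty, BGeometry.S3.isBVolume_volume,
    BGeometry.S3.isRotationalBeltrami, BGeometry.S3.not_vanishesAt_beltrami, ?_⟩
  rintro ⟨γ, hγ, hZ⟩
  obtain ⟨t, ht⟩ := BGeometry.S3.not_isPeriodicOrbit γ hγ
  exact hZ t ht
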